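/- All groups are finite. For a group $G$, a positive integer $m$ and $u,g\in G$ put $G_m(u,g)=\{a\in G : a^m=(au)^m=g\}$. The group $G$ is $FSZ_m$ if $|G_m(u,g)|=|G_m(u,g^n)|$ for all $u,g\in G$ and all positive integers $n$ coprime to $|G|$; it is $FSZ_m^+$ if the centralizer $C_G(g)$ is $FSZ_m$ for every $g\in G$; it is $FSZ$ (respectively $FSZ^+$) if it is $FSZ_m$ (respectively $FSZ_m^+$) for every positive integer $m$. Let $p$ be a prime. Let $Q=\mathbb{Z}_{p^2}\times\mathbb{Z}_p^{p-1}$, written multiplicatively with generators $a_1,\dots,a_p$ of the respective factors, where $a_1$ has order $p^2$ and $a_2,\dots,a_p$ have order $p$. Let $b$ be the automorphism of $Q$ with $a_1\mapsto a_1a_2^{-1}$, $a_k\mapsto a_ka_{k+1}$ for $2\le k<p$, and $a_p\mapsto a_p$, and let $F(p,1)=Q\rtimes\langle b\rangle$. Let $G=F(p,1)\wr_r\mathbb{Z}_p$ be the regular wreath product, that is, the semidirect product $F(p,1)^p\rtimes\mathbb{Z}_p$ in which $\mathbb{Z}_p$ cyclically permutes the factors. Theorem. The group $G$ has order $p^{(p+1)^2}$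 and is $FSZ_p$. It is $FSZ_p^+$ if and only if $p\le 3$. Consequently, if $p>3$, then $G$ is $FSZ$ but not $FSZ^+$. -/

import Mathlib

section FSZ

variable {G : Type*} [Group G]

/-- The set `G_m(u, g) = {a ∈ G : a ^ m = (a * u) ^ m = g}`. -/
def fszSet (m : ℕ) (u g : G) : Set G :=
  {a | a ^ m = g ∧ (a * u) ^ m = g}

variable (G)

/-- The finite group `G` is `FSZ_m`: `|G_m(u, g)| = |G_m(u, g ^ n)|` for all `u, g ∈ G` and all
positive integers `n` coprime to the order of `G`. -/
def IsFSZAt (m : ℕ) : Prop :=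
  ∀ n : ℕ, 0 < n → n.Coprime (Nat.card G) → ∀ u g : G,
    (fszSet m u g).ncard = (fszSet m u (g ^ n)).ncard

/-- The finite group `G` is `FSZ`: it is `FSZ_m` for all positive integers `m`. -/
def IsFSZ : Prop :=
  ∀ m : ℕ, 0 < m → IsFSZAt G m

/-- The finite group `G` is `FSZ_m^+`: the centralizer of every element of `G` is `FSZ_m`. -/
def IsFSZPlusAt (m : ℕ) : Prop :=
  ∀ g : G, IsFSZAt (Subgroup.centralizer ({g} : Set G)) m

/-- The finite group `G` is `FSZ^+`: it is `FSZ_m^+` for all positive integers `m`. -/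
def IsFSZPlus : Prop :=
  ∀ m : ℕ, 0 < m → IsFSZPlusAt G m

end FSZ

section Construction

variable (p : ℕ)

/-- The abelian group `Q = ℤ_{p²} × ℤ_p^{p-1}`, written additively. The generator `a₁` is `(1, 0)`
and, for `2 ≤ k ≤ p`, the generator `a_k` is `(0, e)` with `e` the standard basis vector of
index `k - 2`. -/
abbrev AddQ : Type := ZMod (p ^ 2) × (Fin (p - 1) → ZMod p)

/-- Reduction modulo `p` as a homomorphism `ℤ_{p²} → ℤ_p`. -/
def redModP : ZMod (p ^ 2) →+ ZMod p :=
  (ZMod.castHom (dvd_pow_self p two_ne_zero) (ZMod p)).toAddMonoidHom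

/-- The endomorphism `b` of `Q` with `a₁ ↦ a₁ a₂⁻¹`, `a_k ↦ a_k a_{k+1}` for `2 ≤ k < p` and
`a_p ↦ a_p`, in coordinates: the `a₁`-coordinate `n₁` is kept, the `a₂`-coordinate becomes
`n₂ - n₁`, and for `3 ≤ k ≤ p` the `a_k`-coordinate becomes `n_k + n_{k-1}`. -/
def bEnd : AddQ p →+ AddQ p where
  toFun q := (q.1, fun i => q.2 i +
    if (i : ℕ) = 0 then - redModP p q.1 else q.2 ⟨(i : ℕ) - 1, by omega⟩)
  map_zero' := by
    ext i <;> simp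
  map_add' x y := by
    ext i
    · simp
    · by_cases h : (i : ℕ) = 0
      · simp [h]; ring
      · simp [h]; ring

theorem bEnd_injective : Function.Injective (bEnd p) := by
  rw [injective_iff_map_eq_zero]
  rintro ⟨x, y⟩ h
  have hx : x = 0 := congrArg Prod.fst h
  subst hx
  have hy : ∀ i : Fin (p - 1),
      y i + (if (i : ℕ) = 0 then - redModP p 0 else y ⟨(i : ℕ) - 1, by omega⟩) = 0 :=
    fun i => congrFun (congrArg Prod.snd h) i
  have key : ∀ k : ℕ, ∀ hk : k < p - 1, y ⟨k, hk⟩ = 0 := by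
    intro k
    induction k with
    | zero => intro hk; simpa using hy ⟨0, hk⟩
    | succ k ih =>
      intro hk
      simpa [ih (by omega)] using hy ⟨k + 1, hk⟩
  ext i
  · rfl
  · exact key i i.2

variable [Fact p.Prime]

theorem bEnd_bijective : Function.Bijective (bEnd p) :=
  Finite.injective_iff_bijective.mp (bEnd_injective p)

/-- The automorphism `b` of `Q`, with `Q` written multiplicatively. -/
noncomputable def bAut : MulAut (Multiplicative (AddQ p)) :=
  AddEquiv.toMultiplicative (AddEquiv.ofBijective (bEnd p) (bEnd_bijective p))

/-- The group `F(p, 1) = Q ⋊ ⟨b⟩`. -/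
abbrev FGroup : Type :=
  Multiplicative (AddQ p) ⋊[(Subgroup.zpowers (bAut p)).subtype] Subgroup.zpowers (bAut p)

/-- The regular wreath product `F(p, 1) ≀ᵣ ℤ_p`. -/
abbrev FWreath : Type :=
  RegularWreathProduct (FGroup p) (Multiplicative (ZMod p))

end Construction

/-!
Write `F = F(p, 1)` and `b - 1` for the endomorphism `q ↦ b q - q` of `Q`, which is nilpotent and
killed by `p`. The norm of `⟨b⟩` on `Q` is therefore `p + (b - 1) ^ (p - 1)`, so that for `x ∈ F`
with `a₁`-coordinate `c` the power `x ^ p` equals `a₁ ^ (p c)` if `x ∈ Q`, and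
`a₁ ^ (p c) a_p ^ (-c)` otherwise (`FGroup.pow_prime`). Such powers are central of exponent `p`;
they depend only on `c` modulo `p` and on the component of `x` in `⟨b⟩`, and they determine `c`
modulo `p`. For `n` prime to `p` the automorphism `φ` that raises `Q` to the power `n` and fixes `b`
raises `p`-th powers to the power `n`. These properties are collected in `IsPowerScaling`.

They imply that `G = F ≀ᵣ ℤ_p` is `FSZ_p` (`IsPowerScaling.ncard_fszSet_le`): for every `n` there is
an injection of `G_p(u, g)` into `G_p(u, g ^ n)`, depending on which of `a` and `a u` lie in the base
group. If both do, `φ` is applied to each coordinate. If neither does, `a` is multiplied by the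
element with the single non-trivial coordinate `g(1) ^ (n - 1)`: the `p`-th power of an element
outside the base group contains each coordinate once, and an element of the base group that commutes
with it is determined by one coordinate. In the mixed case `g` is diagonal and central, and `φ` is
applied to each coordinate, after which one coordinate is corrected by an element that does not
change `p`-th powers. The property `FSZ_{p²}` is obtained similarly
(`IsPowerScaling.ncard_fszSet_sq_le`); as the exponent of `G` divides `p³` and factors of `m` prime
to `p` do not matter, `G` is `FSZ`.

For `n ≡ ±1` modulo `m` every finite group satisfies `|G_m(u, g)| = |G_m(u, g ^ n)|`, by the maps
`a ↦ g ^ k a` and `a ↦ g ^ k (a u)⁻¹`. Hence every `p`-group with `p ≤ 3` is `FSZ_p`, in particular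
all centralizers in `G` (`isFSZAt_of_isPGroup_of_le_three`).

For `p > 3`, let `w` lie outside the base group with `w ^ p` the diagonal element `a_p`. The
centralizer of `w` is generated by `w` and the diagonal copy of `F`, and `p`-th powers in it are
`(x w ^ j) ^ p = x ^ p a_p ^ j`. With `u = b w` and `g = a₁ ^ (p c)` the conditions on `a = x w ^ j`
become that `x` has `a₁`-coordinate `c`, that `j` is `0` or `c` according to whether `x ∈ Q`, and
that `j + 1` is `0` or `c` according to whether `x b ∈ Q`. This is solvable for `c = 1`, by `x = a₁`
and `j = 0`, but not for `c = 2` (`FWreath.not_isFSZPlusAt`).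
-/

/-! ### The sets `G_m(u, g)` in an arbitrary finite group -/

section General

theorem ncard_le_of_maps {α : Type*} [Finite α] {A B : Set α} (T : α → α) (hT : ∀ a ∈ A, T a ∈ B)
    (hinj : Set.InjOn T A) : A.ncard ≤ B.ncard :=
  Set.ncard_le_ncard_of_injOn T hT hinj (Set.toFinite B)

/-- Injections between the fibres of a map `r` add up to an injection. -/
theorem ncard_le_of_fibres {α Q : Type*} [Finite α] (r : α → Q) {A B : Set α}
    (h : ∀ t, ∃ T : α → α, (∀ a ∈ A, r a = t → T a ∈ B ∧ r (T a) = t) ∧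
      ∀ a ∈ A, ∀ a' ∈ A, r a = t → r a' = t → T a = T a' → a = a') :
    A.ncard ≤ B.ncard := by
  choose T hT hinj using h
  refine ncard_le_of_maps (fun a => T (r a) a) (fun a ha => (hT _ a ha rfl).1) ?_
  intro a ha a' ha' heq
  have hr : r a = r a' := by
    rw [← (hT _ a ha rfl).2, ← (hT _ a' ha' rfl).2]
    exact congrArg r heq
  refine hinj (r a) a ha a' ha' rfl hr.symm ?_
  simpa only [hr] using heq

variable {G : Type*} [Group G]

theorem fszSet.commute_left {m : ℕ} {u g a : G} (ha : a ∈ fszSet m u g) : Commute a g := by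
  rw [← ha.1]
  exact (Commute.refl a).pow_right m

theorem fszSet.commute_mul {m : ℕ} {u g a : G} (ha : a ∈ fszSet m u g) : Commute (a * u) g := by
  rw [← ha.2]
  exact (Commute.refl (a * u)).pow_right m

/-- Exponents coprime to the group order are invertible: raising to the power `n` is undone by
raising to another power coprime to the group order. -/
theorem exists_pow_pow_eq_self [Finite G] {n : ℕ} (hn : n.Coprime (Nat.card G)) :
    ∃ n' : ℕ, n'.Coprime (Nat.card G) ∧ ∀ g : G, (g ^ n) ^ n' = g := by
  refine ⟨n ^ ((Nat.card G).totient - 1), hn.pow_left _, fun g => ?_⟩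
  have hpos : 0 < (Nat.card G).totient := Nat.totient_pos.2 Nat.card_pos
  rw [← pow_mul, ← pow_succ', Nat.sub_add_cancel hpos]
  conv_rhs => rw [← pow_one g]
  rw [pow_eq_pow_iff_modEq]
  exact (Nat.ModEq.pow_totient hn).of_dvd (orderOf_dvd_natCard g)

/-- As exponents coprime to the group order are invertible, one inequality is enough. -/
theorem isFSZAt_of_le [Finite G] {m : ℕ}
    (h : ∀ n : ℕ, 0 < n → n.Coprime (Nat.card G) → ∀ u g : G,
      (fszSet m u g).ncard ≤ (fszSet m u (g ^ n)).ncard) : IsFSZAt G m := by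
  intro n hn hcop u g
  refine le_antisymm (h n hn hcop u g) ?_
  obtain ⟨n', hcop', hinv⟩ := exists_pow_pow_eq_self hcop
  rcases Nat.eq_zero_or_pos n' with rfl | hn'
  · -- The inverse exponent is `0` only in the trivial group.
    have hG : ∀ x : G, x = 1 := fun x => by simpa using (hinv x).symm
    rw [hG (g ^ n), hG g]
  · simpa only [hinv] using h n' hn' hcop' u (g ^ n)

/-- An exponent `r` coprime to the group order does not affect the `FSZ` property, since
`a ^ (m * r) = g` amounts to `a ^ m = g ^ s` with `s` inverse to `r`. -/
theorem IsFSZAt.mul_of_coprime [Finite G] {m r : ℕ} (h : IsFSZAt G m)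
    (hr : r.Coprime (Nat.card G)) : IsFSZAt G (m * r) := by
  obtain ⟨s, -, hinv⟩ := exists_pow_pow_eq_self hr
  have hiff : ∀ x g : G, x ^ (m * r) = g ↔ x ^ m = g ^ s := by
    intro x g
    rw [pow_mul]
    constructor
    · rintro rfl
      exact (hinv _).symm
    · intro hx
      rw [hx, ← pow_mul, mul_comm, pow_mul, hinv]
  have hset : ∀ u g : G, fszSet (m * r) u g = fszSet m u (g ^ s) := by
    intro u g
    ext a
    simp only [fszSet, Set.mem_ofPred_eq, hiff]
  intro n hn hcop u g
  rw [hset, hset, ← pow_mul, mul_comm n, pow_mul]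
  exact h n hn hcop u _

theorem isFSZAt_one [Finite G] : IsFSZAt G 1 := by
  refine isFSZAt_of_le fun n hn hcop u g => ?_
  obtain ⟨n', -, hinv⟩ := exists_pow_pow_eq_self hcop
  refine ncard_le_of_maps (fun a => a ^ n) ?_ ?_
  · rintro a ⟨h1, h2⟩
    rw [pow_one] at h1 h2
    subst h1
    have hu : u = 1 := by simpa using h2
    simp [fszSet, hu]
  · intro a _ a' _ h
    rw [← hinv a, ← hinv a']
    exact congrArg (· ^ n') h

theorem isFSZAt_of_pow_eq_one {m : ℕ} (h : ∀ a : G, a ^ m = 1) [Finite G] : IsFSZAt G m := by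
  refine isFSZAt_of_le fun n _ _ u g => ?_
  refine ncard_le_of_maps id ?_ Function.injective_id.injOn
  rintro a ⟨h1, h2⟩
  rw [h] at h1 h2
  subst h1
  simp [fszSet, h]

/-- In every group the exponents `n ≡ 1 (mod m)` preserve the cardinality of `G_m(u, g)`: with
`n = m k + 1`, the element `g ^ k` is centralized by `a` and `a u`, so `a ↦ a g ^ k` does it. -/
theorem ncard_fszSet_le_of_eq_mul_add_one [Finite G] {m n k : ℕ} (hn : n = m * k + 1) (u g : G) :
    (fszSet m u g).ncard ≤ (fszSet m u (g ^ n)).ncard := by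
  refine ncard_le_of_maps (fun a => g ^ k * a) ?_ (mul_right_injective _).injOn
  intro a ha
  have hpow : ∀ x : G, Commute x g → x ^ m = g → (g ^ k * x) ^ m = g ^ n := by
    intro x hx hxm
    rw [(hx.symm.pow_left k).mul_pow, hxm, ← pow_mul, ← pow_succ, hn, mul_comm k]
  refine ⟨hpow a (fszSet.commute_left ha) ha.1, ?_⟩
  rw [mul_assoc]
  exact hpow (a * u) (fszSet.commute_mul ha) ha.2

/-- In every group the exponents `n ≡ -1 (mod m)` preserve the cardinality of `G_m(u, g)`: for
`n = -1` the map `a ↦ (a u)⁻¹` does it, because `u` commutes with `g`. -/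
theorem ncard_fszSet_le_of_add_one_eq_mul [Finite G] {m n k : ℕ} (hn : n + 1 = m * k) (u g : G) :
    (fszSet m u g).ncard ≤ (fszSet m u (g ^ n)).ncard := by
  refine ncard_le_of_maps (fun a => g ^ k * (a * u)⁻¹) ?_ ?_
  · intro a ha
    have hpow : ∀ x : G, Commute x g → x ^ m = g⁻¹ → (g ^ k * x) ^ m = g ^ n := by
      intro x hx hxm
      rw [(hx.symm.pow_left k).mul_pow, hxm, ← pow_mul, mul_comm k, ← hn, pow_succ,
        mul_inv_cancel_right]
    have h1 := fszSet.commute_left ha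
    have h2 := fszSet.commute_mul ha
    have hu : Commute u g := by
      simpa using (h1.inv_left).mul_left h2
    have hconj : (a * u)⁻¹ * u = u⁻¹ * a⁻¹ * u⁻¹⁻¹ := by group
    refine ⟨hpow _ h2.inv_left (by rw [inv_pow, ha.2]), ?_⟩
    rw [mul_assoc]
    refine hpow _ (h2.inv_left.mul_left hu) ?_
    rw [hconj, conj_pow, inv_pow, ha.1, (hu.inv_inv).eq, inv_inv, inv_mul_cancel_right]
  · intro a _ a' _ h
    simpa using h

/-- Every unit modulo `2` or `3` is `±1`, so for `p ≤ 3` every `p`-group is `FSZ_p`. -/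
theorem isFSZAt_of_isPGroup_of_le_three [Finite G] {p : ℕ} [hp : Fact p.Prime] (h3 : p ≤ 3)
    (hG : IsPGroup p G) : IsFSZAt G p := by
  refine isFSZAt_of_le fun n hn hcop u g => ?_
  obtain ⟨k, hk⟩ := IsPGroup.iff_card.1 hG
  rcases Nat.eq_zero_or_pos k with rfl | hkpos
  · have hsub : Subsingleton G := (Nat.card_eq_one_iff_unique.1 (by simpa using hk)).1
    rw [Subsingleton.elim (g ^ n) g]
  · have hpn : ¬ p ∣ n := by
      rw [hk, Nat.coprime_pow_right_iff hkpos] at hcop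
      exact (Nat.Prime.coprime_iff_not_dvd hp.out).1 hcop.symm
    have hdiv := Nat.div_add_mod n p
    have hp2 := hp.out.two_le
    have hlt := Nat.mod_lt n hp.out.pos
    have hne : n % p ≠ 0 := fun h0 => hpn (Nat.dvd_of_mod_eq_zero h0)
    have hcases : n % p = 1 ∨ n % p + 1 = p := by omega
    rcases hcases with h1 | h1
    · exact ncard_fszSet_le_of_eq_mul_add_one (k := n / p) (by omega) u g
    · exact ncard_fszSet_le_of_add_one_eq_mul (k := n / p + 1) (by rw [mul_add]; omega) u g

/-- A product over a group of prime order may be taken along the powers of any non-trivial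
element. -/
theorem prod_range_pow_eq_prod {Q M : Type*} [Group Q] [Fintype Q] [CommMonoid M] {p : ℕ}
    [Fact p.Prime] (hQ : Nat.card Q = p) {t : Q} (ht : t ≠ 1) (f : Q → M) :
    ∏ j ∈ Finset.range p, f (t ^ j) = ∏ k, f k := by
  classical
  have hord : orderOf t = p := by
    rw [← hQ]
    exact orderOf_eq_card_of_forall_mem_zpowers fun x => mem_zpowers_of_prime_card hQ ht
  have himg := IsCyclic.image_range_orderOf
    (fun x => mem_zpowers_of_prime_card hQ ht : ∀ x, x ∈ Subgroup.zpowers t)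
  rw [← himg, Finset.prod_image, hord]
  intro i hi j hj hij
  exact pow_injOn_Iio_orderOf (by simpa using hi) (by simpa using hj) hij

end General

/-! ### Powers in a wreath product with a group of prime order -/

namespace RegularWreathProduct

variable {D Q : Type*} [Group D] [Group Q]

open Classical in
/-- The element of the base group with entry `y` at the coordinate `1` and trivial entries
elsewhere. -/
noncomputable def single (y : D) : D ≀ᵣ Q := ⟨Pi.mulSingle 1 y, 1⟩

/-- The diagonal embedding of `D` into the base group. -/
def diag : D →* D ≀ᵣ Q where
  toFun y := ⟨fun _ => y, 1⟩
  map_one' := rfl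
  map_mul' x y := by ext <;> simp

/-- The endomorphism of the wreath product that applies `φ` to every coordinate. -/
def mapLeft (φ : D →* D) : D ≀ᵣ Q →* D ≀ᵣ Q where
  toFun a := ⟨fun k => φ (a.left k), a.right⟩
  map_one' := by ext <;> simp
  map_mul' x y := by ext <;> simp

/-- A homomorphism to a commutative group extends from `D` to the wreath product: multiply its
values over all coordinates. -/
def prodLeft [Fintype Q] {X : Type*} [CommGroup X] (π : D →* X) : D ≀ᵣ Q →* X where
  toFun a := ∏ k, π (a.left k)
  map_one' := by simp
  map_mul' a b := by
    simp only [mul_left, Pi.mul_apply, map_mul, Finset.prod_mul_distrib]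
    congr 1
    exact Fintype.prod_equiv (Equiv.mulLeft a.right⁻¹) _ _ fun k => rfl

@[simp] theorem single_right (y : D) : (single y : D ≀ᵣ Q).right = 1 := rfl

@[simp] theorem single_left_one (y : D) : (single y : D ≀ᵣ Q).left 1 = y := by simp [single]

theorem single_left_of_ne (y : D) {k : Q} (hk : k ≠ 1) : (single y : D ≀ᵣ Q).left k = 1 := by
  simp [single, hk]

@[simp] theorem diag_right (y : D) : (diag y : D ≀ᵣ Q).right = 1 := rfl

@[simp] theorem diag_left (y : D) (k : Q) : (diag y : D ≀ᵣ Q).left k = y := rfl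

@[simp] theorem mapLeft_right (φ : D →* D) (a : D ≀ᵣ Q) : (mapLeft φ a).right = a.right := rfl

@[simp] theorem mapLeft_left (φ : D →* D) (a : D ≀ᵣ Q) (k : Q) :
    (mapLeft φ a).left k = φ (a.left k) := rfl

@[simp] theorem pow_right (a : D ≀ᵣ Q) (m : ℕ) : (a ^ m).right = a.right ^ m :=
  map_pow rightHom a m

theorem mapLeft_injective {φ : D →* D} (hφ : Function.Injective φ) :
    Function.Injective (mapLeft φ : D ≀ᵣ Q →* D ≀ᵣ Q) := by
  intro a b h
  ext k
  · exact hφ (congrFun (congrArg RegularWreathProduct.left h) k)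
  · exact (congrArg RegularWreathProduct.right h :)

theorem mul_left_apply_of_right_eq_one {a : D ≀ᵣ Q} (ha : a.right = 1) (b : D ≀ᵣ Q) (k : Q) :
    (a * b).left k = a.left k * b.left k := by
  simp [ha]

theorem pow_left_apply_of_right_eq_one {a : D ≀ᵣ Q} (ha : a.right = 1) (m : ℕ) (k : Q) :
    (a ^ m).left k = a.left k ^ m := by
  induction m with
  | zero => simp
  | succ m ih =>
    rw [pow_succ', mul_left_apply_of_right_eq_one ha, ih, ← pow_succ']

theorem pow_succ_left_one (a : D ≀ᵣ Q) (m : ℕ) :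
    (a ^ (m + 1)).left 1 = (a ^ m).left 1 * a.left (a.right⁻¹ ^ m) := by
  rw [pow_succ]
  simp

theorem commute_diag_of_central {z : D} (hz : ∀ y : D, Commute z y) (a : D ≀ᵣ Q) :
    Commute (diag z) a := by
  ext k
  · simpa using (hz (a.left k)).eq
  · simp

section Prime

variable {p : ℕ}

theorem right_pow_eq_one (hQ : Nat.card Q = p) (a : D ≀ᵣ Q) : (a ^ p).right = 1 := by
  rw [pow_right, ← hQ, pow_card_eq_one']

variable [hp : Fact p.Prime] (hQ : Nat.card Q = p)

include hQ

/-- Changing the coordinate at `1` of an element outside the base group changes the coordinate at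
`1` of its `p`-th power by the same factor, as each coordinate enters the product exactly once. -/
theorem single_mul_pow_left_one {a : D ≀ᵣ Q} (ha : a.right ≠ 1) (y : D) :
    ((single y * a) ^ p).left 1 = y * (a ^ p).left 1 := by
  have hord : orderOf a.right⁻¹ = p := by
    rw [← hQ]
    exact orderOf_eq_card_of_forall_mem_zpowers fun x =>
      mem_zpowers_of_prime_card hQ (inv_ne_one.2 ha)
  have key : ∀ m : ℕ, m + 1 ≤ p →
      ((single y * a) ^ (m + 1)).left 1 = y * (a ^ (m + 1)).left 1 := by
    intro m
    induction m with
    | zero => intro _; simp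
    | succ m ih =>
      intro hm
      have hne : a.right⁻¹ ^ (m + 1) ≠ 1 :=
        pow_ne_one_of_lt_orderOf (Nat.succ_ne_zero m) (by omega)
      rw [pow_succ_left_one, ih (by omega), pow_succ_left_one a (m + 1), mul_assoc]
      congr 2
      rw [mul_left_apply_of_right_eq_one (single_right y), mul_right, single_right, one_mul,
        single_left_of_ne _ hne, one_mul]
  have hpos := hp.out.pos
  have := key (p - 1) (by omega)
  rwa [Nat.sub_add_cancel hpos] at this

/-- An element of the base group that commutes with some `b` outside the base group is determined
by a single coordinate, as `b` permutes the coordinates transitively. -/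
theorem eq_of_commute {b c c' : D ≀ᵣ Q} (hb : b.right ≠ 1) (hc : c.right = 1) (hc' : c'.right = 1)
    (hbc : Commute b c) (hbc' : Commute b c') (h1 : c.left 1 = c'.left 1) : c = c' := by
  have hstep : ∀ d : D ≀ᵣ Q, d.right = 1 → Commute b d → ∀ k : Q,
      d.left (b.right⁻¹ * k) = (b.left k)⁻¹ * d.left k * b.left k := by
    intro d hd hbd k
    have h := congrFun (congrArg left hbd.eq) k
    rw [mul_left_apply_of_right_eq_one hd] at h
    rw [mul_assoc, ← h]
    simp
  have key : ∀ m : ℕ, c.left (b.right⁻¹ ^ m) = c'.left (b.right⁻¹ ^ m) := by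
    intro m
    induction m with
    | zero => simpa using h1
    | succ m ih =>
      rw [pow_succ', hstep c hc hbc, hstep c' hc' hbc', ih]
  ext k
  · obtain ⟨m, rfl⟩ := Submonoid.mem_powers_iff _ _ |>.1
      (mem_powers_of_prime_card hQ (inv_ne_one.2 hb) : k ∈ Submonoid.powers b.right⁻¹)
    exact key m
  · rw [hc, hc']

theorem map_pow_left_one [Fintype Q] {X : Type*} [CommGroup X] (π : D →* X) {b : D ≀ᵣ Q}
    (hb : b.right ≠ 1) : π ((b ^ p).left 1) = prodLeft π b := by
  have key : ∀ m : ℕ,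
      π ((b ^ m).left 1) = ∏ j ∈ Finset.range m, π (b.left (b.right⁻¹ ^ j)) := by
    intro m
    induction m with
    | zero => simp
    | succ m ih => rw [pow_succ_left_one, map_mul, ih, Finset.prod_range_succ]
  rw [key, prod_range_pow_eq_prod hQ (inv_ne_one.2 hb) fun k => π (b.left k)]
  rfl

/-- If the `p`-th power `g` of an element `b` outside the base group has entry `x` at the coordinate
`1`, then inserting the factor `x ^ (n - 1)` there turns the `p`-th power into `g ^ n`. -/
theorem single_mul_pow_eq {b g : D ≀ᵣ Q} (hb : b.right ≠ 1) (hg : b ^ p = g) {n : ℕ}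
    (hn : 0 < n) : (single (g.left 1 ^ (n - 1)) * b) ^ p = g ^ n := by
  have hgr : g.right = 1 := by rw [← hg, right_pow_eq_one hQ]
  have hr : (single (g.left 1 ^ (n - 1)) * b).right = b.right := by simp
  have hsg : Commute (single (g.left 1 ^ (n - 1))) g := by
    ext k
    · rw [mul_left_apply_of_right_eq_one (single_right _), mul_left_apply_of_right_eq_one hgr]
      rcases eq_or_ne k 1 with rfl | hk
      · rw [single_left_one, ← pow_succ, ← pow_succ']
      · rw [single_left_of_ne _ hk, one_mul, mul_one]
    · simp [hgr]
  have hbg : Commute b g := by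
    rw [← hg]
    exact (Commute.refl b).pow_right p
  refine eq_of_commute hQ (by rw [hr]; exact hb) (right_pow_eq_one hQ _) (by simp [hgr])
    ((Commute.refl _).pow_right p) ((hsg.mul_left hbg).pow_right n) ?_
  rw [single_mul_pow_left_one hQ hb, hg, pow_left_apply_of_right_eq_one hgr, ← pow_succ,
    Nat.sub_add_cancel hn]

/-- An element over `t ≠ 1` whose `p`-th power is the diagonal element with entry `y`, for central
`y`. -/
noncomputable def twist (y : D) (t : Q) : D ≀ᵣ Q := single y * inl t

omit hp hQ in
@[simp] theorem twist_right (y : D) (t : Q) : (twist y t).right = t := by simp [twist]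

omit hp hQ in
theorem commute_twist_diag {y : D} (hy : ∀ x : D, Commute y x) (t : Q) (x : D) :
    Commute (twist y t) (diag x) := by
  ext k
  · rcases eq_or_ne k 1 with rfl | hk
    · simpa [twist] using (hy x).eq
    · simp [twist, single_left_of_ne y hk]
  · simp

theorem twist_pow {y : D} (hy : ∀ x : D, Commute y x) {t : Q} (ht : t ≠ 1) :
    (twist y t) ^ p = diag y := by
  refine eq_of_commute hQ (b := twist y t) (by simpa using ht) (right_pow_eq_one hQ _)
    (diag_right y) ((Commute.refl _).pow_right p) (commute_twist_diag hy t y) ?_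
  rw [twist, single_mul_pow_left_one hQ (by simpa using ht), ← map_pow, ← hQ, pow_card_eq_one']
  simp

/-- The centralizer of `twist y t` is generated by `twist y t` and the diagonal. -/
theorem exists_eq_diag_mul_twist_pow {y : D} (hy : ∀ x : D, Commute y x) {t : Q} (ht : t ≠ 1)
    {a : D ≀ᵣ Q} (ha : Commute (twist y t) a) :
    ∃ (x : D) (j : ℕ), a = diag x * twist y t ^ j := by
  obtain ⟨j, hj⟩ := (Submonoid.mem_powers_iff _ _).1
    (mem_powers_of_prime_card hQ ht : a.right ∈ Submonoid.powers t)
  have hc : a * (twist y t ^ j)⁻¹ = diag ((a * (twist y t ^ j)⁻¹).left 1) :=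
    eq_of_commute hQ (b := twist y t) (by simpa using ht) (by simp [← hj]) (diag_right _)
      (ha.mul_right ((Commute.refl _).pow_right j).inv_right) (commute_twist_diag hy t _) rfl
  exact ⟨_, j, by rw [← hc, inv_mul_cancel_right]⟩

theorem diag_mul_twist_pow_pow {y : D} (hy : ∀ x : D, Commute y x) {t : Q} (ht : t ≠ 1)
    (x : D) (j : ℕ) : (diag x * twist y t ^ j) ^ p = diag (x ^ p * y ^ j) := by
  rw [((commute_twist_diag hy t x).symm.pow_right j).mul_pow, ← pow_mul, mul_comm j, pow_mul,
    twist_pow hQ hy ht, ← map_pow, ← map_pow, ← map_mul]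

end Prime

end RegularWreathProduct

/-! ### The `FSZ` property of wreath products -/

/-- Data that controls `p`-th powers in a group `F`. The homomorphism `π` to a commutative group `X`
of exponent `p` determines `p`-th powers, these are central of exponent `p`, and the endomorphism
`φ` raises them to the power `n`. The condition `map_inv_mul` says that the change of `π` under `φ`
can be read off from the `p`-th power. -/
structure IsPowerScaling (p n : ℕ) {F X : Type*} [Group F] [CommGroup X] (π : F →* X)
    (φ : F →* F) : Prop where
  injective : Function.Injective φ
  pow_eq : ∀ x y : F, π x = π y → x ^ p = y ^ p
  map_inv_mul : ∀ x y : F, x ^ p = y ^ p → π (φ (x⁻¹ * y)) = π (x⁻¹ * y)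
  map_pow : ∀ x : F, φ (x ^ p) = (x ^ p) ^ n
  central : ∀ x y : F, Commute (x ^ p) y
  pow_pow : ∀ x : F, (x ^ p) ^ p = 1
  exponent : ∀ c : X, c ^ p = 1

namespace IsPowerScaling

open RegularWreathProduct

variable {p n : ℕ} {F X Q : Type*} [Group F] [CommGroup X] [Group Q] {π : F →* X} {φ : F →* F}

/-- Scaling `x` by `φ` scales the `p`-th power of both `x` and `x v`, if these agree. -/
theorem map_mul_pow (h : IsPowerScaling p n π φ) {x v : F} (hx : x ^ p = (x * v) ^ p) :
    (φ x * v) ^ p = ((x * v) ^ p) ^ n := by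
  rw [← h.map_pow, _root_.map_pow]
  refine h.pow_eq _ _ ?_
  have := h.map_inv_mul _ _ hx
  rw [inv_mul_cancel_left] at this
  rw [map_mul, map_mul, map_mul, this]

theorem pow_pow_of_right_eq_one (h : IsPowerScaling p n π φ) {a : F ≀ᵣ Q} (ha : a.right = 1) :
    (a ^ p) ^ p = 1 := by
  ext k
  · rw [← pow_mul, pow_left_apply_of_right_eq_one ha, pow_mul, h.pow_pow]
    rfl
  · simp [ha]

variable [hp : Fact p.Prime] [Finite Q]

/-- The elements `a` of the base group for which `a u` lies outside of it. Here `g` is diagonal and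
central, `φ` is applied to all coordinates of `a`, and the coordinate at `1` is then corrected by an
element of the kernel of `π`, so that `(a u) ^ p` becomes the right power of `g`. -/
theorem exists_map_of_right_eq_one (h : IsPowerScaling p n π φ) (hQ : Nat.card Q = p)
    {u : F ≀ᵣ Q} (hu : u.right ≠ 1) (g : F ≀ᵣ Q) :
    ∃ T : F ≀ᵣ Q → F ≀ᵣ Q,
      (∀ a ∈ fszSet p u g, a.right = 1 → T a ∈ fszSet p u (g ^ n) ∧ (T a).right = 1) ∧
      ∀ a ∈ fszSet p u g, ∀ a' ∈ fszSet p u g, a.right = 1 → a'.right = 1 → T a = T a' →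
        a = a' := by
  have := Fintype.ofFinite Q
  set z := g.left 1 with hz
  let y : F ≀ᵣ Q → F := fun a => z ^ n * (((mapLeft φ a * u) ^ p).left 1)⁻¹
  have hur : ∀ a : F ≀ᵣ Q, a.right = 1 → (a * u).right ≠ 1 := fun a ha => by simpa [ha] using hu
  refine ⟨fun a => single (y a) * mapLeft φ a, ?_, ?_⟩
  · intro a ha har
    have hpow : ∀ k, a.left k ^ p = g.left k := fun k => by
      rw [← ha.1, pow_left_apply_of_right_eq_one har]
    have hgr : g.right = 1 := by rw [← ha.1, right_pow_eq_one hQ]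
    have hzc : ∀ x, Commute z x := fun x => by
      rw [hz, ← hpow]
      exact h.central _ _
    have hgz : g = diag z := eq_of_commute hQ (hur a har) hgr (diag_right z)
      (fszSet.commute_mul ha) (commute_diag_of_central hzc _).symm (by simp [hz])
    have hpowz : ∀ k, a.left k ^ p = z := fun k => by rw [hpow, hgz, diag_left]
    have hπz : π z = 1 := by rw [← hpowz 1, _root_.map_pow, h.exponent]
    have hφr : (mapLeft φ a).right = 1 := by simpa using har
    -- The values of `π` on the coordinates of `a` all change by the same factor, which has order
    -- dividing the number `p` of coordinates.
    have hprod : prodLeft π (mapLeft φ a) = prodLeft π a := by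
      have hk : ∀ k, π (φ (a.left k)) =
          π (φ (a.left 1)) * (π (a.left 1))⁻¹ * π (a.left k) := by
        intro k
        have h1 := h.map_inv_mul (a.left 1) (a.left k) (by rw [hpowz, hpowz])
        rw [map_mul, map_mul, map_mul, map_inv, map_inv, map_inv, inv_mul_eq_iff_eq_mul] at h1
        rw [h1, mul_assoc]
      change ∏ k, π (φ (a.left k)) = ∏ k, π (a.left k)
      rw [Finset.prod_congr rfl fun k _ => hk k, Finset.prod_mul_distrib, Finset.prod_const,
        Finset.card_univ, ← Nat.card_eq_fintype_card, hQ, h.exponent, one_mul]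
    have hπy : π (y a) = 1 := by
      change π (z ^ n * (((mapLeft φ a * u) ^ p).left 1)⁻¹) = 1
      rw [map_mul, map_inv, map_pow_left_one hQ π (hur _ hφr), map_mul, hprod, ← map_mul,
        ← map_pow_left_one hQ π (hur a har), ha.2, ← hz, _root_.map_pow, hπz, one_pow, inv_one,
        one_mul]
    have hTr : (single (y a) * mapLeft φ a).right = 1 := by simp [har]
    have hgn : g ^ n = diag (z ^ n) := by rw [hgz, _root_.map_pow]
    refine ⟨⟨?_, ?_⟩, hTr⟩
    · ext k
      · rw [pow_left_apply_of_right_eq_one hTr, pow_left_apply_of_right_eq_one hgr,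
          mul_left_apply_of_right_eq_one (single_right _), mapLeft_left, ← hpow, ← h.map_pow,
          _root_.map_pow]
        refine h.pow_eq _ _ ?_
        rcases eq_or_ne k 1 with rfl | hk
        · rw [single_left_one, map_mul, hπy, one_mul]
        · rw [single_left_of_ne _ hk, one_mul]
      · rw [right_pow_eq_one hQ, pow_right, hgr, one_pow]
    · rw [hgn]
      refine eq_of_commute hQ (hur _ hTr) (right_pow_eq_one hQ _) (diag_right _)
        ((Commute.refl _).pow_right p)
        (commute_diag_of_central (fun x => (hzc x).pow_left n) _).symm ?_
      rw [mul_assoc, single_mul_pow_left_one hQ (hur _ hφr), diag_left]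
      exact inv_mul_cancel_right _ _
  · intro a ha a' ha' har har' hT
    have hk : ∀ k : Q, k ≠ 1 → a.left k = a'.left k := by
      intro k hk
      have := congrFun (congrArg RegularWreathProduct.left hT) k
      simp only [mul_left_apply_of_right_eq_one (single_right _), single_left_of_ne _ hk,
        one_mul, mapLeft_left] at this
      exact h.injective this
    have hsingle : a = single (a.left 1 * (a'.left 1)⁻¹) * a' := by
      ext k
      · rw [mul_left_apply_of_right_eq_one (single_right _)]
        rcases eq_or_ne k 1 with rfl | hk1
        · rw [single_left_one, inv_mul_cancel_right]
        · rw [single_left_of_ne _ hk1, one_mul, hk k hk1]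
      · simp [har, har']
    have h1 := single_mul_pow_left_one hQ (hur a' har') (a.left 1 * (a'.left 1)⁻¹)
    rw [← mul_assoc, ← hsingle, ha.2, ha'.2, right_eq_mul, mul_inv_eq_one] at h1
    ext k
    · rcases eq_or_ne k 1 with rfl | hk1
      · exact h1
      · exact hk k hk1
    · rw [har, har']

/-- The inequality behind `FSZ_p` for the wreath product. The elements `a` are sorted by their
images in the quotient by the base group. -/
theorem ncard_fszSet_le [Finite F] (h : IsPowerScaling p n π φ) (hQ : Nat.card Q = p) (hn : 0 < n)
    (u g : F ≀ᵣ Q) : (fszSet p u g).ncard ≤ (fszSet p u (g ^ n)).ncard := by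
  refine ncard_le_of_fibres RegularWreathProduct.right fun t => ?_
  by_cases ht : t = 1
  · subst ht
    by_cases hu : u.right = 1
    · refine ⟨mapLeft φ, ?_, fun a _ a' _ _ _ hT => mapLeft_injective h.injective hT⟩
      intro a ha har
      have hgr : g.right = 1 := by rw [← ha.1, right_pow_eq_one hQ]
      have haur : (a * u).right = 1 := by simp [har, hu]
      have hk : ∀ k, a.left k ^ p = g.left k ∧ (a.left k * u.left k) ^ p = g.left k := by
        intro k
        constructor
        · rw [← ha.1, pow_left_apply_of_right_eq_one har]
        · rw [← mul_left_apply_of_right_eq_one har, ← pow_left_apply_of_right_eq_one haur, ha.2]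
      refine ⟨⟨?_, ?_⟩, har⟩
      · ext k
        · rw [← _root_.map_pow, ha.1, pow_left_apply_of_right_eq_one hgr, mapLeft_left,
            ← (hk k).1, h.map_pow]
        · simp [har, hgr]
      · have hr : (mapLeft φ a * u).right = 1 := haur
        ext k
        · rw [pow_left_apply_of_right_eq_one hr, pow_left_apply_of_right_eq_one hgr,
            mul_left_apply_of_right_eq_one (by simpa using har), mapLeft_left,
            h.map_mul_pow ((hk k).1.trans (hk k).2.symm), (hk k).2]
        · simp [har, hu, hgr]
    · exact h.exists_map_of_right_eq_one hQ hu g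
  · by_cases htu : t * u.right = 1
    · -- Exchanging the roles of `a` and `a u` leads back to the preceding case.
      have hu : u⁻¹.right ≠ 1 := by
        intro h1
        rw [inv_right, inv_eq_one] at h1
        exact ht (by simpa [h1] using htu)
      have hmem : ∀ a x, a ∈ fszSet p u x ↔ a * u ∈ fszSet p u⁻¹ x := by
        intro a x
        simp only [fszSet, Set.mem_ofPred_eq, mul_inv_cancel_right]
        exact and_comm
      obtain ⟨T, hT, hinj⟩ := h.exists_map_of_right_eq_one hQ hu g
      refine ⟨fun a => T (a * u) * u⁻¹, ?_, ?_⟩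
      · intro a ha har
        obtain ⟨h1, h2⟩ := hT (a * u) ((hmem a g).1 ha) (by simpa [har] using htu)
        refine ⟨?_, ?_⟩
        · rw [hmem, inv_mul_cancel_right]
          exact h1
        · rw [mul_right, h2, inv_right, one_mul]
          exact (eq_inv_of_mul_eq_one_left htu).symm
      · intro a ha a' ha' har har' heq
        exact mul_left_injective u (hinj _ ((hmem a g).1 ha) _ ((hmem a' g).1 ha')
          (by simpa [har] using htu) (by simpa [har'] using htu)
          (mul_left_injective u⁻¹ heq))
    · refine ⟨fun a => single (g.left 1 ^ (n - 1)) * a, ?_,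
        fun a _ a' _ _ _ hT => mul_right_injective _ hT⟩
      intro a ha har
      refine ⟨⟨single_mul_pow_eq hQ (by rwa [har]) ha.1 hn, ?_⟩, by simpa using har⟩
      rw [mul_assoc]
      exact single_mul_pow_eq hQ (by rwa [mul_right, har]) ha.2 hn

/-- The inequality behind `FSZ_{p²}` for the wreath product: unless `g = 1`, both `a` and `a u` lie
outside the base group, `g` is diagonal, and applying `φ` to all coordinates of `a` works. -/
theorem ncard_fszSet_sq_le [Finite F] (h : IsPowerScaling p n π φ) (hQ : Nat.card Q = p) (u g : F ≀ᵣ Q) :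
    (fszSet (p ^ 2) u g).ncard ≤ (fszSet (p ^ 2) u (g ^ n)).ncard := by
  have := Fintype.ofFinite Q
  rcases eq_or_ne g 1 with rfl | hg1
  · rw [one_pow]
  have hout : ∀ b : F ≀ᵣ Q, (b ^ p) ^ p = g → b.right ≠ 1 := fun b hb hb1 =>
    hg1 (by rw [← hb, h.pow_pow_of_right_eq_one hb1])
  refine ncard_le_of_maps (mapLeft φ) ?_ (mapLeft_injective h.injective).injOn
  rintro a ⟨ha1, ha2⟩
  rw [pow_two, pow_mul] at ha1 ha2
  set P := (a ^ p).left 1 with hP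
  set P' := ((a * u) ^ p).left 1 with hP'
  have hgP : P ^ p = g.left 1 := by
    rw [← ha1, pow_left_apply_of_right_eq_one (right_pow_eq_one hQ a)]
  have hgP' : P' ^ p = g.left 1 := by
    rw [← ha2, pow_left_apply_of_right_eq_one (right_pow_eq_one hQ (a * u))]
  have har := hout a ha1
  have haur := hout (a * u) ha2
  have har' : (mapLeft φ a).right ≠ 1 := har
  have haur' : (mapLeft φ a * u).right ≠ 1 := haur
  have hgr : g.right = 1 := by rw [← ha1, right_pow_eq_one hQ]
  have hgc : ∀ x, Commute (g.left 1) x := fun x => by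
    rw [← hgP]
    exact h.central _ _
  have hgdiag : g = diag (g.left 1) := eq_of_commute hQ har hgr (diag_right _)
    (by rw [← ha1]; exact ((Commute.refl a).pow_right p).pow_right p)
    (commute_diag_of_central hgc _).symm rfl
  have hmap : mapLeft φ g = g ^ n := by
    ext k
    · rw [mapLeft_left, pow_left_apply_of_right_eq_one hgr, ← ha1,
        pow_left_apply_of_right_eq_one (right_pow_eq_one hQ a), h.map_pow]
    · simp [hgr]
  -- `π` maps the coordinate at `1` of the `p`-th power of `mapLeft φ a * u` to `π (φ P')`.
  have hπ : π (((mapLeft φ a * u) ^ p).left 1) = π (φ P') := by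
    have h1 : π ((mapLeft φ a ^ p).left 1) = π (φ P) := by
      rw [← _root_.map_pow, mapLeft_left]
    have h2 := h.map_inv_mul P P' (by rw [hgP, hgP'])
    rw [map_mul, map_mul, map_mul, map_inv, map_inv, map_inv, inv_mul_eq_iff_eq_mul] at h2
    rw [map_pow_left_one hQ π haur', map_mul, ← map_pow_left_one hQ π har', h1, h2]
    rw [hP, hP', map_pow_left_one hQ π har, map_pow_left_one hQ π haur, map_mul,
      inv_mul_cancel_left]
  refine ⟨?_, ?_⟩
  · rw [pow_two, pow_mul, ← _root_.map_pow, ← _root_.map_pow, ha1, hmap]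
  · rw [pow_two, pow_mul]
    refine eq_of_commute hQ haur' (right_pow_eq_one hQ _) (by simp [hgr])
      (((Commute.refl _).pow_right p).pow_right p) ?_ ?_
    · rw [hgdiag]
      exact (commute_diag_of_central hgc _).symm.pow_right n
    · rw [pow_left_apply_of_right_eq_one (right_pow_eq_one hQ _),
        pow_left_apply_of_right_eq_one hgr, h.pow_eq _ _ hπ, ← _root_.map_pow, h.map_pow, hgP']

end IsPowerScaling

/-! ### The automorphism `b` and `p`-th powers in `F(p, 1)` -/

section Endomorphism

variable (p : ℕ)

/-- The endomorphism `b`, as an element of the endomorphism ring of `Q`. -/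
def bRing : AddMonoid.End (AddQ p) := bEnd p

/-- The nilpotent endomorphism `b - 1` of `Q`. -/
def nEnd : AddMonoid.End (AddQ p) := bRing p - 1

theorem nEnd_apply (q : AddQ p) : nEnd p q =
    (0, fun i : Fin (p - 1) => if (i : ℕ) = 0 then - redModP p q.1 else q.2 ⟨(i : ℕ) - 1, by omega⟩) := by
  change bEnd p q - q = _
  ext i
  · simp [bEnd]
  · simp [bEnd]

theorem bEnd_apply (q : AddQ p) : bEnd p q = q + nEnd p q := by
  change _ = q + (bEnd p q - q)
  abel

/-- The powers of `b - 1` shift the coordinates, on which `a₁` enters with a sign. -/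
theorem nEnd_pow_succ_apply (k : ℕ) (q : AddQ p) : (nEnd p ^ (k + 1)) q =
    (0, fun i : Fin (p - 1) => if (i : ℕ) < k then 0 else if (i : ℕ) = k then - redModP p q.1 else
      q.2 ⟨(i : ℕ) - (k + 1), by omega⟩) := by
  induction k with
  | zero => simp [nEnd_apply]
  | succ k ih =>
    rw [pow_succ' (nEnd p) (k + 1)]
    change nEnd p ((nEnd p ^ (k + 1)) q) = _
    rw [ih, nEnd_apply]
    ext i
    · rfl
    · simp only [map_zero, neg_zero]
      by_cases h0 : (i : ℕ) = 0
      · simp [h0]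
      · have e1 : ((i : ℕ) - 1 < k) ↔ (i : ℕ) < k + 1 := by omega
        have e2 : ((i : ℕ) - 1 = k) ↔ (i : ℕ) = k + 1 := by omega
        have e3 : (i : ℕ) - 1 - (k + 1) = (i : ℕ) - (k + 1 + 1) := by omega
        simp only [h0, if_false, e1, e2, e3]

variable [hp : Fact p.Prime]

theorem nEnd_pow_pred_apply (q : AddQ p) : (nEnd p ^ (p - 1)) q =
    (0, fun i : Fin (p - 1) => if (i : ℕ) = p - 2 then - redModP p q.1 else 0) := by
  have h2 := hp.out.two_le
  obtain ⟨k, hk⟩ : ∃ k, p - 1 = k + 1 := ⟨p - 2, by omega⟩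
  have hpow : nEnd p ^ (p - 1) = nEnd p ^ (k + 1) := congrArg _ hk
  rw [hpow, nEnd_pow_succ_apply]
  ext i
  · rfl
  · have hi := i.2
    have hk2 : p - 2 = k := by omega
    rcases lt_or_ge (i : ℕ) k with h | h
    · have h' : (i : ℕ) ≠ k := by omega
      simp [h, h', hk2]
    · have h' : (i : ℕ) = k := by omega
      simp [h', hk2]

theorem nsmul_nEnd (q : AddQ p) : p • nEnd p q = 0 := by
  rw [nEnd_apply]
  ext i
  · simp
  · simp

theorem nEnd_nEnd_pow_pred (q : AddQ p) : nEnd p ((nEnd p ^ (p - 1)) q) = 0 := by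
  rw [nEnd_pow_pred_apply, nEnd_apply]
  ext i
  · rfl
  · have hi := i.2
    by_cases h0 : (i : ℕ) = 0
    · simp [h0]
    · have : (i : ℕ) - 1 ≠ p - 2 := by omega
      simp [h0, this]

/-- The norm of `⟨b⟩` on `Q`. In the binomial expansion in powers of `b - 1` the intermediate terms
vanish, because `p (b - 1) = 0`. -/
theorem sum_bEnd_pow : ∑ j ∈ Finset.range p, bRing p ^ j =
    (p : AddMonoid.End (AddQ p)) + nEnd p ^ (p - 1) := by
  have h2 := hp.out.two_le
  have hb : bRing p = nEnd p + 1 := by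
    rw [nEnd, sub_add_cancel]
  have hpoly := congrArg (Polynomial.aeval (nEnd p))
    (Polynomial.geom_sum_X_comp_X_add_one_eq_sum (R := ℤ) p)
  simp only [Polynomial.aeval_comp, map_sum, map_pow, map_add, map_one, map_mul, map_natCast,
    Polynomial.aeval_X] at hpoly
  rw [hb, hpoly]
  obtain ⟨k, hk⟩ : ∃ k, p = k + 2 := ⟨p - 2, by omega⟩
  have hmid : ∀ i ∈ Finset.range k,
      ((p.choose (i + 1 + 1) : ℕ) : AddMonoid.End (AddQ p)) * nEnd p ^ (i + 1) = 0 := by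
    intro i hi
    rw [Finset.mem_range] at hi
    obtain ⟨c, hc⟩ := hp.out.dvd_choose_self (by omega : i + 1 + 1 ≠ 0) (by omega)
    have h0 : (p : AddMonoid.End (AddQ p)) * nEnd p = 0 := by
      ext1 q
      rw [← nsmul_eq_mul]
      exact nsmul_nEnd p q
    rw [hc, mul_comm p c, Nat.cast_mul, mul_assoc, pow_succ' (nEnd p) i,
      ← mul_assoc (p : AddMonoid.End (AddQ p)),
      h0, zero_mul, mul_zero]
  have hsplit : Finset.range p = Finset.range (k + 1 + 1) := by rw [hk]
  rw [hsplit, Finset.sum_range_succ, Finset.sum_range_succ', Finset.sum_eq_zero hmid]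
  have hpow : nEnd p ^ (p - 1) = nEnd p ^ (k + 1) := congrArg _ (by omega)
  have hchoose : p.choose (k + 1 + 1) = 1 := by
    rw [show k + 1 + 1 = p by omega, Nat.choose_self]
  rw [hpow, hchoose]
  simp

theorem bEnd_pow_prime : bRing p ^ p = 1 := by
  have h := geom_sum_mul (bRing p) p
  rw [sum_bEnd_pow] at h
  rw [← sub_eq_zero, ← h]
  change _ * nEnd p = 0
  rw [add_mul, ← pow_succ (nEnd p) (p - 1), pow_succ' (nEnd p) (p - 1), ← nsmul_eq_mul]
  ext1 q
  change p • nEnd p q + nEnd p ((nEnd p ^ (p - 1)) q) = 0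
  rw [nsmul_nEnd, nEnd_nEnd_pow_pred, add_zero]

theorem nsmul_eq_zero_iff_redModP (x : ZMod (p ^ 2)) : p • x = 0 ↔ redModP p x = 0 := by
  have : NeZero (p ^ 2) := ⟨pow_ne_zero 2 hp.out.ne_zero⟩
  obtain ⟨v, rfl⟩ : ∃ v : ℕ, (v : ZMod (p ^ 2)) = x := ⟨x.val, ZMod.natCast_zmod_val x⟩
  have h1 : redModP p (v : ZMod (p ^ 2)) = (v : ZMod p) := by simp [redModP]
  rw [h1, nsmul_eq_mul, ← Nat.cast_mul, ZMod.natCast_eq_zero_iff, ZMod.natCast_eq_zero_iff, pow_two,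
    Nat.mul_dvd_mul_iff_left hp.out.pos]

theorem nsmul_eq_zero_of_redModP {q : AddQ p} (h : redModP p q.1 = 0) : p • q = 0 := by
  ext i
  · exact (nsmul_eq_zero_iff_redModP p q.1).2 h
  · simp

theorem card_multiplicative_addQ : Nat.card (Multiplicative (AddQ p)) = p ^ (p + 1) := by
  have h1 := hp.out.one_le
  have hcard : Nat.card (AddQ p) = p ^ (p + 1) := by
    rw [Nat.card_prod, Nat.card_zmod, Nat.card_fun, Nat.card_zmod, Nat.card_fin, ← pow_add]
    congr 1
    omega
  exact hcard

theorem bAut_pow_apply (j : ℕ) (q : AddQ p) : (bAut p ^ j) (Multiplicative.ofAdd q) =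
    Multiplicative.ofAdd ((bRing p ^ j) q) := by
  induction j with
  | zero => rfl
  | succ j ih => rw [pow_succ' (bAut p) j, pow_succ' (bRing p) j, MulAut.mul_apply, ih]; rfl

theorem bAut_pow_prime : bAut p ^ p = 1 := by
  ext1 q
  obtain ⟨q, rfl⟩ := Multiplicative.ofAdd.surjective q
  rw [bAut_pow_apply, bEnd_pow_prime]
  rfl

theorem bAut_ne_one : bAut p ≠ 1 := by
  intro h
  have h2 := hp.out.two_le
  have h1 : bEnd p (1, 0) = (1, 0) :=
    congrArg Multiplicative.toAdd (DFunLike.congr_fun h (Multiplicative.ofAdd ((1, 0) : AddQ p)))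
  have h3 := congrFun (congrArg Prod.snd h1) ⟨0, by omega⟩
  simp [bEnd, redModP] at h3

theorem card_zpowers_bAut : Nat.card (Subgroup.zpowers (bAut p)) = p := by
  rw [Nat.card_zpowers, orderOf_eq_prime (bAut_pow_prime p) (bAut_ne_one p)]

instance : Finite (Subgroup.zpowers (bAut p)) :=
  Nat.finite_of_card_ne_zero (by rw [card_zpowers_bAut]; exact hp.out.ne_zero)

theorem zpowers_bAut_pow_prime (c : Subgroup.zpowers (bAut p)) : c ^ p = 1 :=
  orderOf_dvd_iff_pow_eq_one.1 ((orderOf_dvd_natCard c).trans (card_zpowers_bAut p).dvd)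

theorem exists_eq_bAut_pow (c : Subgroup.zpowers (bAut p)) :
    ∃ j : ℕ, (c : MulAut (Multiplicative (AddQ p))) = bAut p ^ j := by
  have hfin : IsOfFinOrder (bAut p) := isOfFinOrder_iff_pow_eq_one.2
    ⟨p, hp.out.pos, bAut_pow_prime p⟩
  obtain ⟨j, hj⟩ := (Submonoid.mem_powers_iff _ _).1 (hfin.mem_powers_iff_mem_zpowers.2 c.2)
  exact ⟨j, hj.symm⟩

theorem zpowers_bAut_apply_fst (c : Subgroup.zpowers (bAut p)) (q : Multiplicative (AddQ p)) :
    (Multiplicative.toAdd ((c : MulAut (Multiplicative (AddQ p))) q)).1 =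
      (Multiplicative.toAdd q).1 := by
  obtain ⟨j, hj⟩ := exists_eq_bAut_pow p c
  rw [hj]
  clear hj
  induction j with
  | zero => rfl
  | succ j ih => rw [pow_succ' (bAut p) j, MulAut.mul_apply, ← ih]; rfl

theorem zpowers_bAut_apply_of_nEnd_eq_zero (c : Subgroup.zpowers (bAut p)) {q : AddQ p}
    (hq : nEnd p q = 0) :
    (c : MulAut (Multiplicative (AddQ p))) (Multiplicative.ofAdd q) = Multiplicative.ofAdd q := by
  obtain ⟨j, hj⟩ := exists_eq_bAut_pow p c
  rw [hj]
  clear hj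
  induction j with
  | zero => rfl
  | succ j ih =>
    rw [pow_succ' (bAut p) j, MulAut.mul_apply, ih]
    change Multiplicative.ofAdd (bEnd p q) = _
    rw [bEnd_apply, hq, add_zero]

end Endomorphism

namespace FGroup

open scoped IsMulCommutative

variable (p : ℕ) [hp : Fact p.Prime]

/-- The `a₁`-coordinate modulo `p`, as a homomorphism on `F(p, 1)`. -/
noncomputable def coordHom : FGroup p →* Multiplicative (ZMod p) where
  toFun x := Multiplicative.ofAdd (redModP p (Multiplicative.toAdd x.left).1)
  map_one' := by simp
  map_mul' x y := by
    rw [SemidirectProduct.mul_left, toAdd_mul, Prod.fst_add, map_add, ofAdd_add]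
    congr 3
    exact zpowers_bAut_apply_fst p x.right y.left

/-- The `a₁`-coordinate modulo `p` together with the component in `⟨b⟩`. -/
noncomputable def abHom : FGroup p →* Multiplicative (ZMod p) × Subgroup.zpowers (bAut p) :=
  (coordHom p).prod SemidirectProduct.rightHom

/-- The endomorphism of `F(p, 1)` that is raising to the power `n` on `Q` and fixes `b`. -/
noncomputable def scale (n : ℕ) : FGroup p →* FGroup p :=
  SemidirectProduct.map (powMonoidHom n) (MonoidHom.id _) fun c => by
    refine MonoidHom.ext fun q => ?_
    simp

variable {p}

theorem pow_left (x : FGroup p) (m : ℕ) : (x ^ m).left = ∏ j ∈ Finset.range m,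
    ((x.right ^ j : Subgroup.zpowers (bAut p)) : MulAut (Multiplicative (AddQ p))) x.left := by
  induction m with
  | zero => simp
  | succ m ih =>
    have hr : (x ^ m).right = x.right ^ m := map_pow SemidirectProduct.rightHom x m
    rw [pow_succ x m, SemidirectProduct.mul_left, ih, hr, Finset.prod_range_succ]
    rfl

open Classical in
/-- For `x` outside `Q`, the `p`-th power of `x` involves the norm of `⟨b⟩` on `Q`, whichever
non-trivial power of `b` occurs in `x`. -/
theorem pow_prime (x : FGroup p) : x ^ p = SemidirectProduct.inl (Multiplicative.ofAdd
    (p • Multiplicative.toAdd x.left +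
      if x.right = 1 then 0 else (nEnd p ^ (p - 1)) (Multiplicative.toAdd x.left))) := by
  have := Fintype.ofFinite (Subgroup.zpowers (bAut p))
  ext1
  · rw [pow_left, SemidirectProduct.left_inl]
    by_cases h : x.right = 1
    · rw [if_pos h, add_zero, h]
      simp only [one_pow, OneMemClass.coe_one, MulAut.one_apply, Finset.prod_const,
        Finset.card_range]
      rfl
    · rw [if_neg h, prod_range_pow_eq_prod (card_zpowers_bAut p) h
        fun c => (c : MulAut (Multiplicative (AddQ p))) x.left]
      have hb : (⟨bAut p, Subgroup.mem_zpowers _⟩ : Subgroup.zpowers (bAut p)) ≠ 1 := by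
        intro h1
        exact bAut_ne_one p (congrArg Subtype.val h1)
      rw [← prod_range_pow_eq_prod (card_zpowers_bAut p) hb
        fun c => (c : MulAut (Multiplicative (AddQ p))) x.left]
      obtain ⟨q, hq⟩ := Multiplicative.ofAdd.surjective x.left
      rw [← hq]
      simp only [SubmonoidClass.mk_pow, bAut_pow_apply, toAdd_ofAdd]
      rw [← ofAdd_sum]
      congr 1
      have hs := DFunLike.congr_fun (sum_bEnd_pow p) q
      have hsum : (∑ j ∈ Finset.range p, bRing p ^ j) q = ∑ j ∈ Finset.range p, (bRing p ^ j) q :=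
        map_sum (AddMonoidHom.eval q : AddMonoid.End (AddQ p) →+ AddQ p) _ _
      rw [← hsum, hs]
      rfl
  · have hr : (x ^ p).right = x.right ^ p := map_pow SemidirectProduct.rightHom x p
    rw [hr, SemidirectProduct.right_inl]
    exact zpowers_bAut_pow_prime p _

theorem coordHom_eq_of_pow_eq {x y : FGroup p} (h : x ^ p = y ^ p) :
    coordHom p x = coordHom p y := by
  classical
  rw [pow_prime, pow_prime, SemidirectProduct.inl_inj] at h
  have h1 := congrArg (fun q : Multiplicative (AddQ p) => (Multiplicative.toAdd q).1) h
  have hz : ∀ z : FGroup p, (if z.right = 1 then 0 else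
      (nEnd p ^ (p - 1)) (Multiplicative.toAdd z.left) : AddQ p).1 = 0 := by
    intro z
    split_ifs
    · rfl
    · rw [nEnd_pow_pred_apply]
  simp only [toAdd_ofAdd, Prod.fst_add, hz, add_zero, Prod.smul_fst] at h1
  rw [← sub_eq_zero, ← smul_sub, nsmul_eq_zero_iff_redModP, map_sub, sub_eq_zero] at h1
  exact congrArg Multiplicative.ofAdd h1

theorem pow_eq_of_abHom_eq {x y : FGroup p} (h : abHom p x = abHom p y) : x ^ p = y ^ p := by
  classical
  have h1 : redModP p (Multiplicative.toAdd x.left).1 = redModP p (Multiplicative.toAdd y.left).1 :=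
    congrArg (fun c => Multiplicative.toAdd c.1) h
  have h2 : x.right = y.right := congrArg Prod.snd h
  have h3 : p • Multiplicative.toAdd x.left = p • Multiplicative.toAdd y.left := by
    rw [← sub_eq_zero, ← smul_sub]
    exact nsmul_eq_zero_of_redModP p (by rw [Prod.fst_sub, map_sub, h1, sub_self])
  rw [pow_prime, pow_prime, h2, h3, nEnd_pow_pred_apply, nEnd_pow_pred_apply, h1]

theorem commute_inl_of_nEnd_eq_zero {q : AddQ p} (hq : nEnd p q = 0) (y : FGroup p) :
    Commute (SemidirectProduct.inl (Multiplicative.ofAdd q)) y := by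
  ext1
  · simp only [SemidirectProduct.mul_left, SemidirectProduct.left_inl, SemidirectProduct.right_inl,
      map_one, MulAut.one_apply]
    rw [mul_comm]
    congr 1
    exact (zpowers_bAut_apply_of_nEnd_eq_zero p y.right hq).symm
  · simp

theorem pow_pow_prime_eq_one (x : FGroup p) : (x ^ p) ^ p = 1 := by
  have h0 : coordHom p (x ^ p) = coordHom p 1 := by
    rw [map_pow, map_one]
    have h1 : Nat.card (Multiplicative (ZMod p)) = p := Nat.card_zmod p
    exact orderOf_dvd_iff_pow_eq_one.1 ((orderOf_dvd_natCard _).trans h1.dvd)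
  have h1 : (x ^ p).right = 1 := by
    classical
    rw [pow_prime, SemidirectProduct.right_inl]
  rw [pow_eq_of_abHom_eq (Prod.ext h0 h1 : abHom p (x ^ p) = abHom p 1), one_pow]

theorem commute_pow_prime (x y : FGroup p) : Commute (x ^ p) y := by
  classical
  rw [pow_prime]
  refine commute_inl_of_nEnd_eq_zero ?_ y
  rw [map_add, map_nsmul, nsmul_nEnd, zero_add]
  split_ifs
  · exact map_zero _
  · exact nEnd_nEnd_pow_pred p _

theorem scale_injective {n : ℕ} (hn : n.Coprime p) : Function.Injective (scale p n) := by
  intro x y h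
  have hcop : (Nat.card (Multiplicative (AddQ p))).Coprime n := by
    rw [card_multiplicative_addQ]
    exact (hn.symm.pow_left _)
  ext1
  · exact (powCoprime hcop).injective (congrArg SemidirectProduct.left h :)
  · exact (congrArg SemidirectProduct.right h :)

theorem scale_pow_prime (n : ℕ) (x : FGroup p) : scale p n (x ^ p) = (x ^ p) ^ n := by
  classical
  rw [pow_prime, scale, SemidirectProduct.map_inl, ← map_pow, powMonoidHom_apply]

theorem abHom_scale_of_coordHom_eq_one {x : FGroup p} (hx : coordHom p x = 1) (n : ℕ) :
    abHom p (scale p n x) = abHom p x := by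
  have h1 : redModP p (Multiplicative.toAdd x.left).1 = 0 := hx
  have h2 : coordHom p (scale p n x) = coordHom p x := by
    change Multiplicative.ofAdd (redModP p (n • (Multiplicative.toAdd x.left).1)) =
      Multiplicative.ofAdd (redModP p (Multiplicative.toAdd x.left).1)
    rw [map_nsmul, h1, smul_zero]
  exact Prod.ext h2 rfl

theorem isPowerScaling_scale {n : ℕ} (hn : n.Coprime p) :
    IsPowerScaling (X := Multiplicative (ZMod p) × Subgroup.zpowers (bAut p)) p n (abHom p)
      (scale p n) where
  injective := scale_injective hn
  pow_eq _ _ h := pow_eq_of_abHom_eq h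
  map_inv_mul x y h := abHom_scale_of_coordHom_eq_one
    (by rw [map_mul, map_inv, coordHom_eq_of_pow_eq h, inv_mul_cancel]) n
  map_pow := scale_pow_prime n
  central := commute_pow_prime
  pow_pow := pow_pow_prime_eq_one
  exponent c := by
    have h1 : Nat.card (Multiplicative (ZMod p)) = p := Nat.card_zmod p
    have hc : c.1 ^ p = 1 :=
      orderOf_dvd_iff_pow_eq_one.1 ((orderOf_dvd_natCard c.1).trans h1.dvd)
    exact Prod.ext hc (zpowers_bAut_pow_prime p c.2)

variable (p) in
theorem card : Nat.card (FGroup p) = p ^ (p + 2) := by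
  rw [SemidirectProduct.card, card_multiplicative_addQ, card_zpowers_bAut, ← pow_succ]

instance : Finite (FGroup p) :=
  Nat.finite_of_card_ne_zero (by rw [card]; exact pow_ne_zero _ hp.out.ne_zero)

end FGroup

/-! ### A centralizer that is not `FSZ_p` -/

namespace FGroup

variable (p : ℕ) [hp : Fact p.Prime]

/-- The generator `a₁` of `Q` in `F(p, 1)`. -/
noncomputable def genFirst : FGroup p := SemidirectProduct.inl (Multiplicative.ofAdd (1, 0))

/-- The generator `a_p` of `Q` in `F(p, 1)`, obtained by applying `(b - 1) ^ (p - 1)` to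
`a₁⁻¹`. -/
noncomputable def genLast : FGroup p :=
  SemidirectProduct.inl (Multiplicative.ofAdd ((nEnd p ^ (p - 1)) (-1, 0)))

/-- The element `b` of `F(p, 1)`. -/
noncomputable def genB : FGroup p := SemidirectProduct.inr ⟨bAut p, Subgroup.mem_zpowers _⟩

theorem genLast_commute (x : FGroup p) : Commute (genLast p) x :=
  commute_inl_of_nEnd_eq_zero (nEnd_nEnd_pow_pred p _) x

theorem mul_genB_left (x : FGroup p) : (x * genB p).left = x.left := by
  rw [SemidirectProduct.mul_left, genB, SemidirectProduct.left_inr, map_one, mul_one]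

theorem mul_genB_right (x : FGroup p) :
    (x * genB p).right = x.right * ⟨bAut p, Subgroup.mem_zpowers _⟩ := rfl

theorem genFirst_pow : genFirst p ^ p =
    SemidirectProduct.inl (Multiplicative.ofAdd (p • (1, 0))) := by
  classical
  rw [pow_prime, genFirst, SemidirectProduct.right_inl, if_pos rfl, add_zero]
  rfl

theorem genFirst_mul_genB_pow : (genFirst p * genB p) ^ p * genLast p = genFirst p ^ p := by
  classical
  have hb : (genFirst p * genB p).right ≠ 1 := by
    rw [mul_genB_right, genFirst, SemidirectProduct.right_inl, one_mul]
    intro h1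
    exact bAut_ne_one p (congrArg Subtype.val h1)
  have hneg : ((-1, 0) : AddQ p) = -(1, 0) := by simp
  rw [pow_prime, if_neg hb, genFirst_pow, mul_genB_left, genLast, ← map_mul, ← ofAdd_add, genFirst,
    SemidirectProduct.left_inl, toAdd_ofAdd, hneg, map_neg, add_neg_cancel_right]

/-- The `a_p`-coordinate, on `Q`. -/
def lastCoord : AddQ p →+ ZMod p :=
  (Pi.evalAddMonoidHom _ ⟨p - 2, by have := hp.out.two_le; omega⟩).comp (AddMonoidHom.snd _ _)

theorem lastCoord_nEnd_pow_pred (q : AddQ p) :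
    lastCoord p ((nEnd p ^ (p - 1)) q) = - redModP p q.1 := by
  rw [nEnd_pow_pred_apply]
  simp [lastCoord]

open Classical in
/-- The equation `x ^ p * a_p ^ j = a₁ ^ (2 p)` in coordinates. -/
theorem coord_of_pow_mul_eq {x : FGroup p} {j : ℕ}
    (h : x ^ p * genLast p ^ j = (genFirst p ^ p) ^ 2) :
    redModP p (Multiplicative.toAdd x.left).1 = 2 ∧
      (if x.right = 1 then (0 : ZMod p) else -2) + j = 0 := by
  have hred : redModP p (-1, (0 : Fin (p - 1) → ZMod p)).1 = -1 := by simp [redModP]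
  replace h : p • Multiplicative.toAdd x.left +
      (if x.right = 1 then 0 else (nEnd p ^ (p - 1)) (Multiplicative.toAdd x.left)) +
      j • (nEnd p ^ (p - 1)) (-1, 0) = 2 • (p • ((1, 0) : AddQ p)) := by
    have hj : genLast p ^ j = SemidirectProduct.inl
        (Multiplicative.ofAdd (j • (nEnd p ^ (p - 1)) (-1, 0))) :=
      (map_pow SemidirectProduct.inl _ j).symm
    rw [pow_prime, genFirst_pow, hj] at h
    exact congrArg (fun y : FGroup p => Multiplicative.toAdd y.left)
      ((map_mul SemidirectProduct.inl _ _).trans (h.trans (map_pow SemidirectProduct.inl _ 2).symm))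
  have h1 : redModP p (Multiplicative.toAdd x.left).1 = 2 := by
    have hfst := congrArg Prod.fst h
    have hz : (if x.right = 1 then 0 else
        (nEnd p ^ (p - 1)) (Multiplicative.toAdd x.left) : AddQ p).1 = 0 := by
      split_ifs
      · rfl
      · rw [nEnd_pow_pred_apply]
    rw [Prod.fst_add, Prod.fst_add, hz, nEnd_pow_pred_apply] at hfst
    simp only [Prod.smul_fst, smul_zero, add_zero] at hfst
    rw [smul_comm, ← sub_eq_zero, ← smul_sub, nsmul_eq_zero_iff_redModP, map_sub, sub_eq_zero]
      at hfst
    have hone : redModP p 1 = 1 := map_one (ZMod.castHom (dvd_pow_self p two_ne_zero) (ZMod p))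
    rw [hfst, map_nsmul, hone]
    norm_num
  refine ⟨h1, ?_⟩
  have hlast := congrArg (lastCoord p) h
  have hp0 : ∀ z : ZMod p, p • z = 0 := fun z => by simp
  rw [map_add, map_add, map_nsmul, map_nsmul, map_nsmul, map_nsmul, hp0, hp0, zero_add, smul_zero,
    lastCoord_nEnd_pow_pred, hred, apply_ite (lastCoord p), map_zero, lastCoord_nEnd_pow_pred, h1,
    neg_neg] at hlast
  simpa using hlast

/-- The equations `x ^ p a_p ^ j = a₁ ^ (2 p)` and `(x b) ^ p a_p ^ (j + 1) = a₁ ^ (2 p)` together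
force one of `0`, `2`, `-2` to equal `1` modulo `p`. -/
theorem false_of_pow_mul_eq (h3 : 3 < p) {x : FGroup p} {j : ℕ}
    (h : x ^ p * genLast p ^ j = (genFirst p ^ p) ^ 2)
    (h' : (x * genB p) ^ p * genLast p ^ (j + 1) = (genFirst p ^ p) ^ 2) : False := by
  classical
  have e1 := (coord_of_pow_mul_eq p h).2
  have e2 := (coord_of_pow_mul_eq p h').2
  have hthree : (3 : ZMod p) ≠ 0 := by
    intro h0
    have : ((3 : ℕ) : ZMod p) = 0 := by exact_mod_cast h0
    rw [ZMod.natCast_eq_zero_iff] at this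
    exact absurd (Nat.le_of_dvd (by norm_num) this) (by omega)
  have hone : (1 : ZMod p) ≠ 0 := one_ne_zero
  rw [Nat.cast_add, Nat.cast_one] at e2
  split_ifs at e1 e2
  · exact hone (by linear_combination e2 - e1)
  · exact hone (by linear_combination e1 - e2)
  · exact hthree (by linear_combination e2 - e1)
  · exact hone (by linear_combination e2 - e1)

end FGroup

/-! ### The group `F(p, 1) ≀ᵣ ℤ_p` -/

namespace FWreath

open RegularWreathProduct
open scoped IsMulCommutative

theorem card_top (p : ℕ) : Nat.card (Multiplicative (ZMod p)) = p := Nat.card_zmod p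

variable (p : ℕ) [hp : Fact p.Prime]

theorem card : Nat.card (FWreath p) = p ^ ((p + 1) ^ 2) := by
  rw [RegularWreathProduct.card, FGroup.card, card_top, ← pow_mul, ← pow_succ]
  congr 1
  ring

theorem isPGroup : IsPGroup p (FWreath p) := IsPGroup.of_card (card p)

theorem coprime_card_iff {n : ℕ} : n.Coprime (Nat.card (FWreath p)) ↔ n.Coprime p := by
  rw [card, Nat.coprime_pow_right_iff (by positivity)]

theorem isFSZAt_prime : IsFSZAt (FWreath p) p :=
  isFSZAt_of_le fun _ hn hcop u g =>
    (FGroup.isPowerScaling_scale ((coprime_card_iff p).1 hcop)).ncard_fszSet_le (card_top p) hn u g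

theorem isFSZAt_prime_sq : IsFSZAt (FWreath p) (p ^ 2) :=
  isFSZAt_of_le fun _ _ hcop u g =>
    (FGroup.isPowerScaling_scale ((coprime_card_iff p).1 hcop)).ncard_fszSet_sq_le (card_top p) u g

theorem pow_prime_cube (a : FWreath p) : a ^ p ^ 3 = 1 := by
  have hpow : a ^ p ^ 3 = ((a ^ p) ^ p) ^ p := by
    rw [← pow_mul, ← pow_mul]
    exact congrArg (a ^ ·) (by ring)
  rw [hpow]
  exact (FGroup.isPowerScaling_scale (Nat.coprime_one_left p)).pow_pow_of_right_eq_one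
    (right_pow_eq_one (card_top p) a)

theorem isFSZ : IsFSZ (FWreath p) := by
  intro m hm
  obtain ⟨j, r, hr, rfl⟩ := Nat.exists_eq_pow_mul_and_not_dvd hm.ne' p hp.out.ne_one
  have hcop : r.Coprime (Nat.card (FWreath p)) :=
    (coprime_card_iff p).2 ((Nat.Prime.coprime_iff_not_dvd hp.out).2 hr).symm
  refine IsFSZAt.mul_of_coprime ?_ hcop
  match j with
  | 0 => exact isFSZAt_one
  | 1 => rw [pow_one]; exact isFSZAt_prime p
  | 2 => exact isFSZAt_prime_sq p
  | j + 3 =>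
    refine isFSZAt_of_pow_eq_one fun a => ?_
    rw [pow_add, mul_comm, pow_mul, pow_prime_cube, one_pow]

theorem isFSZPlusAt_of_le_three (h3 : p ≤ 3) : IsFSZPlusAt (FWreath p) p := fun _ =>
  isFSZAt_of_isPGroup_of_le_three h3 ((isPGroup p).to_subgroup _)

/-- For `w = twist a_p 1` and `p > 3`, the elements `u = diag b * w` and `g = diag (a₁ ^ p)` of the
centralizer of `w` violate `FSZ_p` with the exponent `2`: the set for `g` contains `diag a₁`,
whereas the set for `g ^ 2` is empty. -/
theorem not_isFSZPlusAt (h3 : 3 < p) : ¬ IsFSZPlusAt (FWreath p) p := by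
  intro hplus
  have hQ := card_top p
  have ht : (Multiplicative.ofAdd (1 : ZMod p)) ≠ 1 := fun h =>
    one_ne_zero (α := ZMod p) (Multiplicative.ofAdd.injective h)
  have hy := FGroup.genLast_commute p
  set w : FWreath p := twist (FGroup.genLast p) (Multiplicative.ofAdd (1 : ZMod p)) with hw
  have hdiag : ∀ x, Commute w (diag x) := commute_twist_diag hy _
  have hpow : ∀ x j, (diag x * w ^ j) ^ p = diag (x ^ p * FGroup.genLast p ^ j) :=
    diag_mul_twist_pow_pow hQ hy ht
  have hmul : ∀ x j, diag x * w ^ j * (diag (FGroup.genB p) * w) =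
      diag (x * FGroup.genB p) * w ^ (j + 1) := by
    intro x j
    rw [mul_assoc, ← mul_assoc (w ^ j), ((hdiag _).pow_left j).eq, mul_assoc, ← pow_succ,
      ← mul_assoc, ← map_mul]
  have hmem : ∀ a : FWreath p, Commute w a → a ∈ Subgroup.centralizer ({w} : Set (FWreath p)) :=
    fun a ha => Subgroup.mem_centralizer_singleton_iff.2 ha.eq.symm
  let u : Subgroup.centralizer ({w} : Set (FWreath p)) :=
    ⟨diag (FGroup.genB p) * w, hmem _ ((hdiag _).mul_right (Commute.refl w))⟩
  let g : Subgroup.centralizer ({w} : Set (FWreath p)) :=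
    ⟨diag (FGroup.genFirst p ^ p), hmem _ (hdiag _)⟩
  have hcop : Nat.Coprime 2 (Nat.card (Subgroup.centralizer ({w} : Set (FWreath p)))) := by
    refine Nat.Coprime.of_dvd_right (Subgroup.card_subgroup_dvd_card _) ?_
    rw [coprime_card_iff]
    exact (Nat.coprime_primes Nat.prime_two hp.out).2 (by omega)
  have heq := hplus w 2 two_pos hcop u g
  have hempty : fszSet p u (g ^ 2) = ∅ := by
    rw [Set.eq_empty_iff_forall_notMem]
    rintro ⟨a, ha⟩ ⟨h1, h2⟩
    replace h1 : a ^ p = diag (FGroup.genFirst p ^ p) ^ 2 := congrArg Subtype.val h1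
    replace h2 : (a * (diag (FGroup.genB p) * w)) ^ p = diag (FGroup.genFirst p ^ p) ^ 2 :=
      congrArg Subtype.val h2
    obtain ⟨x, j, rfl⟩ := exists_eq_diag_mul_twist_pow hQ hy ht
      (Subgroup.mem_centralizer_singleton_iff.1 ha).symm
    rw [← hw, hpow, ← map_pow] at h1
    rw [← hw, hmul, hpow, ← map_pow] at h2
    exact FGroup.false_of_pow_mul_eq p h3 (congrFun (congrArg RegularWreathProduct.left h1) 1)
      (congrFun (congrArg RegularWreathProduct.left h2) 1)
  rw [hempty, Set.ncard_empty, Set.ncard_eq_zero (Set.toFinite _)] at heq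
  have hin : (⟨diag (FGroup.genFirst p), hmem _ (hdiag _)⟩ :
      Subgroup.centralizer ({w} : Set (FWreath p))) ∈ fszSet p u g := by
    refine ⟨Subtype.ext (map_pow diag _ p).symm, Subtype.ext ?_⟩
    change (diag (FGroup.genFirst p) * (diag (FGroup.genB p) * w)) ^ p =
      diag (FGroup.genFirst p ^ p)
    have h1 := hpow (FGroup.genFirst p * FGroup.genB p) 1
    rwa [pow_one, pow_one, FGroup.genFirst_mul_genB_pow, map_mul, mul_assoc] at h1
  rw [heq] at hin
  exact hin

end FWreath

theorem mainTheorem1 (p : ℕ) [Fact p.Prime] :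
    Nat.card (FWreath p) = p ^ ((p + 1) ^ 2) ∧
    IsFSZAt (FWreath p) p ∧
    (IsFSZPlusAt (FWreath p) p ↔ p ≤ 3) ∧
    (3 < p → IsFSZ (FWreath p) ∧ ¬ IsFSZPlus (FWreath p)) := by
  refine ⟨FWreath.card p, FWreath.isFSZAt_prime p, ⟨fun h => ?_,
    FWreath.isFSZPlusAt_of_le_three p⟩, fun h3 => ⟨FWreath.isFSZ p, fun h => ?_⟩⟩
  · by_contra h3
    exact FWreath.not_isFSZPlusAt p (not_le.1 h3) h
  · exact FWreath.not_isFSZPlusAt p h3 (h p (Fact.out : p.Prime).pos)
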